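/- Let $(\Omega,\beta,\mu)$ be a finite measure space, let $X$ be a reflexive Banach space with norm $\|\cdot\|_X$, and write $\|f\|_p=\left(\int_\Omega\|f\|_X^p\,d\mu\right)^{1/p}$ for the norm of $L_p(\Omega,X)$. Let $\tau:\Omega\to\Omega$ be an endomorphism, i.e. a measurable $\mu$-preserving map, let $T$ be the operator generated by $\tau$, $Tg=g\circ\tau$, and put $S_ng=\frac1n\sum_{i=0}^{n-1}T^ig$ for $n\ge 1$. Let $(F_n)$ be a monotone (increasing or decreasing) sequence of $\sigma$-subalgebras of $\beta$, and let $E(\cdot\,|F_n)$ be the conditional expectation of $X$-valued functions. For real $m\ge 0$ let $L(\Omega,X)[\log^+L(\Omega,X)]^m$ be the class of measurable $g:\Omega\to X$ with $$\int_\Omega\|g\|_X\,[\log\max(1,\|g\|_X)]^m\,d\mu<\infty$$ (so for $m=0$ it is $L_1(\Omega,X)$), written $L[\log^+L]^m$ when $X=\mathbb R$. 1. If $p>1$, $f\in L_p(\Omega,X)$ and $\sup_{n_2}\|E(f|F_{n_2})\|_X\in L_1$, then $$\Big\|\sup_{n_1,n_2}\|S_{n_1}E(f|F_{n_2})\|_X\Big\|_p\le\left(\frac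 p{p-1}\right)^2\|f\|_p.$$ 2. If $m\ge 0$ and $f\in L(\Omega,X)[\log^+L(\Omega,X)]^{m+2}$, then $\sup_{n_1,n_2}\|S_{n_1}E(f|F_{n_2})\|_X$ is finite a.e. and belongs to $L[\log^+L]^m$. -/

import Mathlib

open MeasureTheory
open scoped ENNReal

/-- A real Banach space is reflexive if its canonical embedding into the bidual is onto. -/
def IsReflexiveSpace (X : Type*) [NormedAddCommGroup X] [NormedSpace ℝ X] : Prop :=
  Function.Surjective (NormedSpace.inclusionInDoubleDual ℝ X)

/-- Membership of an `X`-valued function in the class `L(Ω, X) [log⁺ L(Ω, X)] ^ m`: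
`g` is (strongly) measurable and `‖g‖ (log max (1, ‖g‖)) ^ m` is integrable.
For `m = 0` the second factor is `1`, so that the class is `L₁(Ω, X)`. -/
def MemLLogL {Ω X : Type*} [MeasurableSpace Ω] [NormedAddCommGroup X]
    (m : ℝ) (g : Ω → X) (μ : Measure Ω) : Prop :=
  AEStronglyMeasurable g μ ∧
    Integrable (fun ω => ‖g ω‖ * Real.log (max 1 ‖g ω‖) ^ m) μ

/-- The supremum over `n₁ ≥ 1` and over `n₂` of `‖S_{n₁} E(f | F_{n₂})‖`, as a function with values
in `[0, ∞]`. Here `T g = g ∘ τ` is the operator generated by `τ`, and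
`S_n g = (1 / n) ∑_{i < n} T ^ i g` is `birkhoffAverage ℝ τ g n`. -/
noncomputable def ergodicMartingaleSup {Ω X : Type*} [MeasurableSpace Ω]
    [NormedAddCommGroup X] [NormedSpace ℝ X] [CompleteSpace X]
    (μ : Measure Ω) (τ : Ω → Ω) (F : ℕ → MeasurableSpace Ω) (f : Ω → X) (ω : Ω) : ℝ≥0∞ :=
  ⨆ (n₁ : ℕ) (_ : 1 ≤ n₁) (n₂ : ℕ), ‖birkhoffAverage ℝ τ (μ[f|F n₂]) n₁ ω‖ₑ

/-! The triangle inequality bounds the double supremum pointwise by the ergodic maximal function of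
the scalar function h = sup over n of ‖E(f | F n)‖ (`ergodicMartingaleSup_le`), so the problem
splits into two successive maximal operators.

Both satisfy the same localized weak type inequality, t μ{M > t} ≤ ∫ f over {M > t}: Doob's
inequality for the pair (‖f‖, h), `mul_meas_iSup_condExp_le`, and Hopf's maximal ergodic theorem for
h and its ergodic supremum, `mul_meas_ergodicSup_le`. Everything else is real analysis on that
inequality. Integrated against powers of t and combined with Hölder, it gives the constant p / (p -
1) (`lintegral_rpow_le_of_weakType`); integrated against logarithmic weights it costs one logarithm
(`lintegral_mul_log_rpow_ne_top_of_weakType`). Two applications give the squared constant and the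
loss of two logarithms. -/

/-! ### Maximal inequality for martingales -/

/-- The conditional expectation contracts the `L₁` norm over measurable sets of the conditioning
`σ`-algebra. -/
lemma setLIntegral_enorm_condExp_le {Ω X : Type*} {mΩ : MeasurableSpace Ω}
    [NormedAddCommGroup X] [NormedSpace ℝ X] [CompleteSpace X]
    (μ : Measure Ω) [IsFiniteMeasure μ] {m : MeasurableSpace Ω} (hm : m ≤ mΩ) {f : Ω → X}
    (hf : Integrable f μ) {s : Set Ω} (hs : MeasurableSet[m] s) :
    ∫⁻ ω in s, ‖(μ[f|m]) ω‖ₑ ∂μ ≤ ∫⁻ ω in s, ‖f ω‖ₑ ∂μ := by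
  have h1 : eLpNorm (μ[s.indicator f|m]) 1 μ ≤ eLpNorm (s.indicator f) 1 μ :=
    eLpNorm_condExp_le_eLpNorm _ le_rfl
  rw [eLpNorm_congr_ae (condExp_indicator hf hs), eLpNorm_one_eq_lintegral_enorm,
    eLpNorm_one_eq_lintegral_enorm] at h1
  simpa only [enorm_indicator_eq_indicator_enorm, lintegral_indicator (hm s hs)] using h1

/-- Doob's maximal inequality over finitely many times, for increasing `σ`-algebras. -/
lemma mul_meas_exists_condExp_le_of_monotone {Ω X : Type*} {mΩ : MeasurableSpace Ω}
    [NormedAddCommGroup X] [NormedSpace ℝ X] [CompleteSpace X]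
    (μ : Measure Ω) [IsFiniteMeasure μ] {F : ℕ → MeasurableSpace Ω} (hFle : ∀ n, F n ≤ mΩ)
    (hF : Monotone F) {f : Ω → X} (hf : Integrable f μ) (t : ℝ≥0∞) (N : ℕ) :
    t * μ {ω | ∃ n ≤ N, t < ‖(μ[f|F n]) ω‖ₑ} ≤
      ∫⁻ ω in {ω | ∃ n ≤ N, t < ‖(μ[f|F n]) ω‖ₑ}, ‖f ω‖ₑ ∂μ := by
  set B : ℕ → Set Ω := fun n => {ω | t < ‖(μ[f|F n]) ω‖ₑ}
  have hB : ∀ n, MeasurableSet[F n] (B n) := fun n =>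
    measurableSet_lt (mδ := F n) measurable_const stronglyMeasurable_condExp.enorm
  -- `disjointed B n` is the event that level t is first exceeded at time n. It lies in `F n`
  -- because F increases, so the contraction on `F n`-sets applies to it.
  have hD : ∀ n, MeasurableSet[F n] (disjointed B n) := fun n => by
    rw [disjointed_eq_inter_compl]
    refine MeasurableSet.inter (hB n) ?_
    exact MeasurableSet.iInter fun j => MeasurableSet.iInter fun hj =>
      (hF (le_of_lt hj) _ (hB j)).compl
  have hset : {ω | ∃ n ≤ N, t < ‖(μ[f|F n]) ω‖ₑ} = ⋃ n ∈ Finset.range (N + 1), disjointed B n := by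
    rw [biUnion_range_succ_disjointed, partialSups_eq_biSup]
    ext ω
    simp [B]
  have hdis : Set.PairwiseDisjoint (↑(Finset.range (N + 1))) (disjointed B) :=
    fun i _ j _ hij => disjoint_disjointed B hij
  rw [hset, measure_biUnion_finset hdis fun n _ => hFle n _ (hD n),
    lintegral_biUnion_finset hdis fun n _ => hFle n _ (hD n), Finset.mul_sum]
  refine Finset.sum_le_sum fun n _ => le_trans ?_
    (setLIntegral_enorm_condExp_le μ (hFle n) hf (hD n))
  rw [← setLIntegral_const]
  exact setLIntegral_mono' (hFle n _ (hD n)) fun ω hω => le_of_lt (disjointed_subset B n hω)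

/-- Doob's maximal inequality for a monotone sequence of `σ`-algebras. -/
lemma mul_meas_iSup_condExp_le {Ω X : Type*} {mΩ : MeasurableSpace Ω}
    [NormedAddCommGroup X] [NormedSpace ℝ X] [CompleteSpace X]
    (μ : Measure Ω) [IsFiniteMeasure μ] {F : ℕ → MeasurableSpace Ω} (hFle : ∀ n, F n ≤ mΩ)
    (hF : Monotone F ∨ Antitone F) {f : Ω → X} (hf : Integrable f μ) (t : ℝ≥0∞) :
    t * μ {ω | t < ⨆ n, ‖(μ[f|F n]) ω‖ₑ} ≤
      ∫⁻ ω in {ω | t < ⨆ n, ‖(μ[f|F n]) ω‖ₑ}, ‖f ω‖ₑ ∂μ := by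
  have hfin : ∀ N, t * μ {ω | ∃ n ≤ N, t < ‖(μ[f|F n]) ω‖ₑ} ≤
      ∫⁻ ω in {ω | ∃ n ≤ N, t < ‖(μ[f|F n]) ω‖ₑ}, ‖f ω‖ₑ ∂μ := by
    intro N
    rcases hF with hF | hF
    · exact mul_meas_exists_condExp_le_of_monotone μ hFle hF hf t N
    -- A decreasing sequence is reversed on the finite horizon; past N the truncated subtraction
    -- keeps it constant at `F 0`, so it stays monotone.
    · have h := mul_meas_exists_condExp_le_of_monotone μ (F := fun n => F (N - n))
        (fun n => hFle _) (fun i j hij => hF (by omega)) hf t N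
      have hset : {ω | ∃ n ≤ N, t < ‖(μ[f|F (N - n)]) ω‖ₑ} =
          {ω | ∃ n ≤ N, t < ‖(μ[f|F n]) ω‖ₑ} := by
        ext ω
        constructor
        · rintro ⟨n, -, h⟩
          exact ⟨N - n, by omega, h⟩
        · rintro ⟨n, hn, h⟩
          exact ⟨N - n, by omega, by rwa [Nat.sub_sub_self hn]⟩
      rwa [hset] at h
  have hset : {ω | t < ⨆ n, ‖(μ[f|F n]) ω‖ₑ} = ⋃ N, {ω | ∃ n ≤ N, t < ‖(μ[f|F n]) ω‖ₑ} := by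
    ext ω
    simp only [lt_iSup_iff, Set.mem_ofPred_eq, Set.mem_iUnion]
    exact ⟨fun ⟨n, h⟩ => ⟨n, n, le_rfl, h⟩, fun ⟨_, n, _, h⟩ => ⟨n, h⟩⟩
  have hmono : Monotone fun N => {ω | ∃ n ≤ N, t < ‖(μ[f|F n]) ω‖ₑ} :=
    fun i j hij ω ⟨n, hn, h⟩ => ⟨n, hn.trans hij, h⟩
  rw [hset, hmono.measure_iUnion, ENNReal.mul_iSup]
  exact iSup_le fun N => (hfin N).trans (lintegral_mono_set
    (Set.subset_iUnion (fun N => {ω | ∃ n ≤ N, t < ‖(μ[f|F n]) ω‖ₑ}) N))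

/-! ### Maximal ergodic inequality -/

/-- The maximum of `0` and the first `N` Birkhoff sums. -/
noncomputable def birkhoffMax {Ω : Type*} (τ : Ω → Ω) (g : Ω → ℝ) : ℕ → Ω → ℝ
  | 0 => 0
  | N + 1 => fun x => max 0 (g x + birkhoffMax τ g N (τ x))

lemma birkhoffMax_nonneg {Ω : Type*} (τ : Ω → Ω) (g : Ω → ℝ) (N : ℕ) (x : Ω) :
    0 ≤ birkhoffMax τ g N x := by
  cases N
  · exact le_rfl
  · exact le_max_left _ _

lemma birkhoffMax_le_succ {Ω : Type*} (τ : Ω → Ω) (g : Ω → ℝ) (N : ℕ) (x : Ω) :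
    birkhoffMax τ g N x ≤ birkhoffMax τ g (N + 1) x := by
  induction N generalizing x with
  | zero => exact birkhoffMax_nonneg τ g 1 x
  | succ N ih => exact max_le_max le_rfl (by gcongr; exact ih (τ x))

/-- By induction along `birkhoffSum_succ'`, the recursive maximum dominates each sum up to N and is
attained by one of them. The index k = 0 is harmless, since the empty sum is 0. -/
lemma birkhoffMax_pos_iff {Ω : Type*} (τ : Ω → Ω) (g : Ω → ℝ) (N : ℕ) (x : Ω) :
    0 < birkhoffMax τ g N x ↔ ∃ k ≤ N, 0 < birkhoffSum τ g k x := by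
  have hle : ∀ N x, ∀ k ≤ N, birkhoffSum τ g k x ≤ birkhoffMax τ g N x := by
    intro N
    induction N with
    | zero =>
      intro x k hk
      simp [Nat.le_zero.mp hk, birkhoffMax]
    | succ N ih =>
      rintro x (_ | k) hk
      · simpa using birkhoffMax_nonneg τ g (N + 1) x
      · rw [birkhoffSum_succ']
        exact le_max_of_le_right (by gcongr; exact ih (τ x) k (by omega))
  have hex : ∀ N x, ∃ k ≤ N, birkhoffMax τ g N x = birkhoffSum τ g k x := by
    intro N
    induction N with
    | zero => exact fun x => ⟨0, le_rfl, by simp [birkhoffMax]⟩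
    | succ N ih =>
      intro x
      rcases max_choice 0 (g x + birkhoffMax τ g N (τ x)) with h | h
      · exact ⟨0, by omega, by simpa [birkhoffMax] using h⟩
      · obtain ⟨k, hk, hk'⟩ := ih (τ x)
        exact ⟨k + 1, by omega, by rw [birkhoffSum_succ', ← hk']; exact h⟩
  constructor
  · intro h
    obtain ⟨k, hk, hk'⟩ := hex N x
    exact ⟨k, hk, hk' ▸ h⟩
  · rintro ⟨k, hk, h⟩
    exact h.trans_le (hle N x k hk)

/-- Hopf's maximal ergodic theorem. -/
lemma setIntegral_birkhoffMax_pos_nonneg {Ω : Type*} [MeasurableSpace Ω] {μ : Measure Ω}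
    {τ : Ω → Ω} (hτ : MeasurePreserving τ μ μ) {g : Ω → ℝ} (hg : Measurable g)
    (hgi : Integrable g μ) (N : ℕ) :
    0 ≤ ∫ x in {x | 0 < birkhoffMax τ g N x}, g x ∂μ := by
  have hmeas : ∀ N, Measurable (birkhoffMax τ g N) := by
    intro N
    induction N with
    | zero => exact measurable_const
    | succ N ih => exact measurable_const.max (hg.add (ih.comp hτ.measurable))
  have hint : ∀ N, Integrable (birkhoffMax τ g N) μ := by
    intro N
    induction N with
    | zero => exact integrable_zero _ _ _
    | succ N ih =>
      exact (integrable_zero _ _ _).sup (hgi.add (hτ.integrable_comp_of_integrable ih))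
  have hs : MeasurableSet {x | 0 < birkhoffMax τ g N x} :=
    measurableSet_lt measurable_const (hmeas N)
  have hcomp : Integrable (fun x => birkhoffMax τ g N (τ x)) μ :=
    hτ.integrable_comp_of_integrable (hint N)
  -- Garsia's argument: where the maximum m is positive, m - m ∘ τ ≤ g. Over that set m has its full
  -- integral and m ∘ τ at most its own, and the two full integrals agree by invariance.
  have hpt : ∀ x ∈ {x | 0 < birkhoffMax τ g N x},
      birkhoffMax τ g N x - birkhoffMax τ g N (τ x) ≤ g x := by
    intro x hx
    cases N with
    | zero => exact (lt_irrefl (0 : ℝ) hx).elim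
    | succ N =>
      have h2 := birkhoffMax_le_succ τ g N (τ x)
      have h3 : birkhoffMax τ g (N + 1) x = g x + birkhoffMax τ g N (τ x) :=
        max_eq_right (le_of_not_ge fun h => (ne_of_gt hx) (max_eq_left h))
      linarith
  have h1 := setIntegral_mono_on ((hint N).sub hcomp).integrableOn hgi.integrableOn hs hpt
  refine le_trans ?_ h1
  rw [integral_sub' (hint N).integrableOn hcomp.integrableOn]
  have h4 : ∫ x in {x | 0 < birkhoffMax τ g N x}, birkhoffMax τ g N x ∂μ =
      ∫ x, birkhoffMax τ g N x ∂μ :=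
    setIntegral_eq_integral_of_forall_compl_eq_zero fun x hx =>
      le_antisymm (not_lt.mp hx) (birkhoffMax_nonneg τ g N x)
  have h5 : ∫ x in {x | 0 < birkhoffMax τ g N x}, birkhoffMax τ g N (τ x) ∂μ ≤
      ∫ x, birkhoffMax τ g N (τ x) ∂μ :=
    setIntegral_le_integral hcomp (ae_of_all _ fun x => birkhoffMax_nonneg τ g N (τ x))
  have h6 : ∫ x, birkhoffMax τ g N (τ x) ∂μ = ∫ x, birkhoffMax τ g N x ∂μ := by
    rw [← integral_map hτ.measurable.aemeasurable (hmeas N).aestronglyMeasurable, hτ.map_eq]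
  linarith

/-- The supremum of the averages of a `[0, ∞]`-valued function along an orbit. -/
noncomputable def ergodicSup {Ω : Type*} (τ : Ω → Ω) (h : Ω → ℝ≥0∞) (x : Ω) : ℝ≥0∞ :=
  ⨆ (k : ℕ) (_ : 1 ≤ k), (k : ℝ≥0∞)⁻¹ * ∑ i ∈ Finset.range k, h (τ^[i] x)

lemma measurable_ergodicSup {Ω : Type*} [MeasurableSpace Ω] {τ : Ω → Ω} (hτ : Measurable τ)
    {h : Ω → ℝ≥0∞} (hh : Measurable h) : Measurable (ergodicSup τ h) := by
  refine Measurable.iSup fun k => Measurable.iSup fun _ => Measurable.const_mul ?_ _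
  exact Finset.measurable_fun_sum _ fun i _ => hh.comp (hτ.iterate i)

/-- For k = 0 the right side reads 0 < 0, so the constraint 1 ≤ k can be dropped. -/
lemma lt_ergodicSup_iff {Ω : Type*} {τ : Ω → Ω} {h : Ω → ℝ≥0∞} {x : Ω} {t : ℝ≥0∞} :
    t < ergodicSup τ h x ↔ ∃ k : ℕ, k * t < ∑ i ∈ Finset.range k, h (τ^[i] x) := by
  simp only [ergodicSup, lt_iSup_iff]
  refine exists_congr fun k => ?_
  rcases Nat.eq_zero_or_pos k with rfl | hk
  · simp
  · have h0 : (k : ℝ≥0∞) ≠ 0 := by exact_mod_cast hk.ne'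
    rw [mul_comm, ← div_eq_mul_inv, ENNReal.lt_div_iff_mul_lt (Or.inl h0)
      (Or.inl (ENNReal.natCast_ne_top k)), mul_comm]
    exact ⟨fun ⟨_, h⟩ => h, fun h => ⟨hk, h⟩⟩

/-- The weak type maximal ergodic inequality. -/
lemma mul_meas_ergodicSup_le {Ω : Type*} [MeasurableSpace Ω] {μ : Measure Ω} [IsFiniteMeasure μ]
    {τ : Ω → Ω} (hτ : MeasurePreserving τ μ μ) {h : Ω → ℝ≥0∞} (hh : Measurable h) {t : ℝ≥0∞}
    (ht : t ≠ ∞) :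
    t * μ {x | t < ergodicSup τ h x} ≤ ∫⁻ x in {x | t < ergodicSup τ h x}, h x ∂μ := by
  -- Truncation makes the function integrable, as Hopf's theorem needs. The same N bounds both the
  -- values and the orbit length, so the sets `A N` form one increasing sequence.
  set u : ℕ → Ω → ℝ≥0∞ := fun N x => min (h x) N
  have hu : ∀ N, Measurable (u N) := fun N => hh.min measurable_const
  have hutop : ∀ N x, u N x ≠ ∞ := fun N x =>
    ne_top_of_le_ne_top (ENNReal.natCast_ne_top N) (min_le_right _ _)
  set A : ℕ → Set Ω := fun N => {x | ∃ k ≤ N, k * t < ∑ i ∈ Finset.range k, u N (τ^[i] x)}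
  have hA : ∀ N, t * μ (A N) ≤ ∫⁻ x in A N, h x ∂μ := by
    intro N
    set g : Ω → ℝ := fun x => (u N x).toReal - t.toReal
    have hg : Measurable g := (hu N).ennreal_toReal.sub measurable_const
    have hui : Integrable (fun x => (u N x).toReal) μ := by
      refine integrable_toReal_of_lintegral_ne_top (hu N).aemeasurable ?_
      refine ne_top_of_le_ne_top ?_ (lintegral_mono (g := fun _ => (N : ℝ≥0∞))
        fun x => min_le_right _ _)
      simp [ENNReal.mul_eq_top]
    have hgi : Integrable g μ := hui.sub (integrable_const _)
    have hAeq : A N = {x | 0 < birkhoffMax τ g N x} := by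
      ext x
      simp only [A, Set.mem_ofPred_eq, birkhoffMax_pos_iff]
      refine exists_congr fun k => and_congr_right fun _ => ?_
      rw [← ENNReal.toReal_lt_toReal (ENNReal.mul_ne_top (ENNReal.natCast_ne_top k) ht)
        (ENNReal.sum_ne_top.mpr fun i _ => hutop N _), ENNReal.toReal_sum fun i _ => hutop N _]
      simp [birkhoffSum, g]
    have hAm : MeasurableSet (A N) := by
      have : A N = ⋃ k : ℕ, ⋃ _ : k ≤ N, {x | k * t < ∑ i ∈ Finset.range k, u N (τ^[i] x)} := by
        ext x; simp [A]
      rw [this]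
      exact MeasurableSet.iUnion fun k => MeasurableSet.iUnion fun _ =>
        measurableSet_lt measurable_const
          (Finset.measurable_fun_sum _ fun i _ => (hu N).comp (hτ.measurable.iterate i))
    have hmain := setIntegral_birkhoffMax_pos_nonneg hτ hg hgi N
    rw [← hAeq, integral_sub hui.integrableOn (integrable_const _), setIntegral_const,
      integral_toReal (hu N).aemeasurable (ae_of_all _ fun x => (hutop N x).lt_top),
      sub_nonneg, smul_eq_mul, Measure.real, ← ENNReal.toReal_mul,
      ENNReal.toReal_le_toReal (ENNReal.mul_ne_top (measure_ne_top _ _) ht)] at hmain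
    · rw [mul_comm]
      exact hmain.trans (lintegral_mono fun x => min_le_left _ _)
    · refine ne_top_of_le_ne_top ?_ (lintegral_mono (g := fun _ => (N : ℝ≥0∞))
        fun x => min_le_right _ _)
      simp [ENNReal.mul_eq_top]
  have hmono : Monotone A := by
    rintro i j hij x ⟨k, hk, hx⟩
    refine ⟨k, hk.trans hij, hx.trans_le (Finset.sum_le_sum fun l _ => ?_)⟩
    exact min_le_min le_rfl (by exact_mod_cast hij)
  have hset : {x | t < ergodicSup τ h x} = ⋃ N, A N := by
    ext x
    simp only [Set.mem_ofPred_eq, lt_ergodicSup_iff, Set.mem_iUnion, A]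
    constructor
    · rintro ⟨k, hk⟩
      have htend : Filter.Tendsto (fun N => ∑ i ∈ Finset.range k, u N (τ^[i] x)) Filter.atTop
          (nhds (∑ i ∈ Finset.range k, h (τ^[i] x))) := by
        refine tendsto_finsetSum _ fun i _ => ?_
        have := (tendsto_const_nhds (x := h (τ^[i] x))).min ENNReal.tendsto_nat_nhds_top
        simpa only [min_eq_left (le_top (a := h (τ^[i] x)))] using this
      obtain ⟨N, hN, hkN⟩ := ((htend.eventually (lt_mem_nhds hk)).and
        (Filter.eventually_ge_atTop k)).exists
      exact ⟨N, k, hkN, hN⟩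
    · rintro ⟨N, k, -, hk⟩
      exact ⟨k, hk.trans_le (Finset.sum_le_sum fun l _ => min_le_left _ _)⟩
  rw [hset, hmono.measure_iUnion, ENNReal.mul_iSup]
  exact iSup_le fun N => (hA N).trans (lintegral_mono_set (Set.subset_iUnion _ N))

/-! ### From weak type to strong type inequalities -/

/-- The weak type inequality for truncations. -/
lemma ofReal_mul_meas_truncation_le {Ω : Type*} [MeasurableSpace Ω] {μ : Measure Ω}
    {f M : Ω → ℝ≥0∞}
    (hw : ∀ t : ℝ≥0∞, t ≠ ∞ → t * μ {x | t < M x} ≤ ∫⁻ x in {x | t < M x}, f x ∂μ)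
    (K : ℕ) {t : ℝ} (ht : 0 ≤ t) :
    ENNReal.ofReal t * μ {x | t < (min (M x) K).toReal} ≤
      ∫⁻ x in {x | t < (min (M x) K).toReal}, f x ∂μ := by
  have htop : ∀ x, min (M x) K ≠ ∞ := fun x =>
    ne_top_of_le_ne_top (ENNReal.natCast_ne_top K) (min_le_right _ _)
  by_cases hK : ENNReal.ofReal t < K
  · have : {x | t < (min (M x) K).toReal} = {x | ENNReal.ofReal t < M x} := by
      ext x
      simp [← ENNReal.ofReal_lt_iff_lt_toReal ht (htop x), hK]
    rw [this]
    exact hw _ ENNReal.ofReal_ne_top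
  · have : {x | t < (min (M x) K).toReal} = ∅ := by
      ext x
      simp [← ENNReal.ofReal_lt_iff_lt_toReal ht (htop x), hK]
    simp [this]

/-- A weak type inequality with a localized right hand side gives the strong type `(p, p)`
inequality with constant `p / (p - 1)`, here for truncations. -/
lemma lintegral_truncation_rpow_le {Ω : Type*} [MeasurableSpace Ω] {μ : Measure Ω}
    [IsFiniteMeasure μ] {f M : Ω → ℝ≥0∞} (hf : AEMeasurable f μ) (hM : Measurable M)
    (hw : ∀ t : ℝ≥0∞, t ≠ ∞ → t * μ {x | t < M x} ≤ ∫⁻ x in {x | t < M x}, f x ∂μ)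
    {p : ℝ} (hp : 1 < p) (K : ℕ) :
    (∫⁻ x, (min (M x) K) ^ p ∂μ) ^ (1 / p) ≤
      ENNReal.ofReal (p / (p - 1)) * (∫⁻ x, f x ^ p ∂μ) ^ (1 / p) := by
  have hp0 : 0 < p := by linarith
  have hp1 : 0 < p - 1 := by linarith
  have htop : ∀ x, min (M x) K ≠ ∞ := fun x =>
    ne_top_of_le_ne_top (ENNReal.natCast_ne_top K) (min_le_right _ _)
  set G : Ω → ℝ := fun x => (min (M x) K).toReal with hG
  have hGm : Measurable G := (hM.min measurable_const).ennreal_toReal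
  have hG0 : ∀ x, 0 ≤ G x := fun x => ENNReal.toReal_nonneg
  have hGp : ∀ r : ℝ, 0 ≤ r → ∀ x, ENNReal.ofReal (G x ^ r) = (min (M x) K) ^ r := fun r hr x => by
    rw [← ENNReal.ofReal_rpow_of_nonneg (hG0 x) hr, hG, ENNReal.ofReal_toReal (htop x)]
  set I := ∫⁻ x, (min (M x) K) ^ p ∂μ with hI
  -- The layer cake formula under μ and under f dμ turns the weak type inequality into I ≤ p / (p -
  -- 1) ∫ f (M ∧ K)^(p - 1) dμ.
  set ν := μ.withDensity f with hν
  have hIle : I ≤ ENNReal.ofReal (p / (p - 1)) * ∫⁻ x, (min (M x) K) ^ (p - 1) ∂ν := by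
    have e1 := lintegral_rpow_eq_lintegral_meas_lt_mul μ (ae_of_all _ hG0) hGm.aemeasurable hp0
    have e2 := lintegral_rpow_eq_lintegral_meas_lt_mul ν (ae_of_all _ hG0) hGm.aemeasurable hp1
    simp_rw [hGp p hp0.le] at e1
    simp_rw [hGp (p - 1) hp1.le] at e2
    rw [hI, e1, e2, ENNReal.ofReal_div_of_pos hp1, ← mul_assoc, ENNReal.div_mul_cancel
      (by simpa using hp1) ENNReal.ofReal_ne_top]
    refine mul_le_mul' le_rfl (setLIntegral_mono' measurableSet_Ioi fun t ht => ?_)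
    have ht : 0 < t := ht
    have hsplit : t ^ (p - 1) = t * t ^ (p - 1 - 1) := by
      rw [mul_comm, ← Real.rpow_add_one ht.ne']
      ring_nf
    rw [hsplit, ENNReal.ofReal_mul ht.le, ← mul_assoc, mul_comm (μ _), hν, withDensity_apply']
    gcongr
    exact ofReal_mul_meas_truncation_le hw K ht.le
  have hpq : p.HolderConjugate (p / (p - 1)) := Real.HolderConjugate.conjExponent hp
  have hmm : Measurable fun x => (min (M x) K) ^ (p - 1) := (hM.min measurable_const).pow_const _
  have hHolder : ∫⁻ x, (min (M x) K) ^ (p - 1) ∂ν ≤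
      (∫⁻ x, f x ^ p ∂μ) ^ (1 / p) * I ^ (1 / (p / (p - 1))) := by
    rw [hν, lintegral_withDensity_eq_lintegral_mul₀ hf hmm.aemeasurable]
    refine (ENNReal.lintegral_mul_le_Lp_mul_Lq μ hpq hf hmm.aemeasurable).trans (le_of_eq ?_)
    simp_rw [← ENNReal.rpow_mul, mul_div_cancel₀ p hp1.ne', hI]
  -- This finiteness is the purpose of truncating: the factor I^(1/q) coming from Hölder, q = p / (p
  -- - 1), is cancelled below.
  have hItop : I ≠ ∞ := by
    refine ne_top_of_le_ne_top ?_ (lintegral_mono (g := fun _ => (K : ℝ≥0∞) ^ p)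
      fun x => ENNReal.rpow_le_rpow (min_le_right _ _) hp0.le)
    rw [lintegral_const]
    exact ENNReal.mul_ne_top (ENNReal.rpow_ne_top_of_nonneg hp0.le (ENNReal.natCast_ne_top K))
      (measure_ne_top _ _)
  rcases eq_or_ne I 0 with h0 | h0
  · rw [h0, ENNReal.zero_rpow_of_pos (by positivity)]
    exact zero_le
  have hJ0 : I ^ (1 / (p / (p - 1))) ≠ 0 := by simp [h0, hItop]
  have hJtop : I ^ (1 / (p / (p - 1))) ≠ ∞ := ENNReal.rpow_ne_top_of_nonneg (by positivity) hItop
  rw [← ENNReal.mul_le_mul_iff_left hJ0 hJtop, ← ENNReal.rpow_add _ _ h0 hItop, mul_assoc]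
  have hone : 1 / p + 1 / (p / (p - 1)) = 1 := by field_simp; ring
  rw [hone, ENNReal.rpow_one]
  exact hIle.trans (by gcongr)

/-- A weak type inequality with a localized right hand side gives the strong type `(p, p)`
inequality with constant `p / (p - 1)`. -/
lemma lintegral_rpow_le_of_weakType {Ω : Type*} [MeasurableSpace Ω] {μ : Measure Ω}
    [IsFiniteMeasure μ] {f M : Ω → ℝ≥0∞} (hf : AEMeasurable f μ) (hM : Measurable M)
    (hw : ∀ t : ℝ≥0∞, t ≠ ∞ → t * μ {x | t < M x} ≤ ∫⁻ x in {x | t < M x}, f x ∂μ)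
    {p : ℝ} (hp : 1 < p) :
    (∫⁻ x, M x ^ p ∂μ) ^ (1 / p) ≤
      ENNReal.ofReal (p / (p - 1)) * (∫⁻ x, f x ^ p ∂μ) ^ (1 / p) := by
  have hp0 : 0 < p := by linarith
  have hsup : ∀ x, M x ^ p = ⨆ K : ℕ, (min (M x) K) ^ p := by
    intro x
    have h1 : Filter.Tendsto (fun K : ℕ => min (M x) K) Filter.atTop (nhds (M x)) := by
      have := (tendsto_const_nhds (x := M x)).min ENNReal.tendsto_nat_nhds_top
      simpa only [min_eq_left (le_top (a := M x))] using this
    refine tendsto_nhds_unique ((ENNReal.continuous_rpow_const.tendsto _).comp h1)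
      (tendsto_atTop_iSup fun i j hij => ENNReal.rpow_le_rpow (min_le_min le_rfl ?_) hp0.le)
    exact_mod_cast hij
  have hmono : Monotone fun (K : ℕ) x => (min (M x) (K : ℝ≥0∞)) ^ p := fun i j hij x =>
    ENNReal.rpow_le_rpow (min_le_min le_rfl (by exact_mod_cast hij)) hp0.le
  simp_rw [hsup]
  rw [lintegral_iSup (fun K => (hM.min measurable_const).pow_const _) hmono,
    one_div, ENNReal.rpow_inv_le_iff hp0]
  refine iSup_le fun K => (ENNReal.rpow_inv_le_iff hp0).mp ?_
  simpa only [one_div] using lintegral_truncation_rpow_le hf hM hw hp K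

/-! ### From weak type inequalities to the classes `L log ^ m L` -/

/-- This weight w(s) drives the logarithmic estimates: ∫ w grows like log^(m + 1), whereas ∫ s w(s)
grows like y log^m y. Using log (1 + s) avoids any singularity at 0. -/
lemma continuousOn_log_one_add_rpow_div {m : ℝ} (hm : 0 ≤ m) :
    ContinuousOn (fun s : ℝ => Real.log (1 + s) ^ m / (1 + s)) (Set.Ici 0) := by
  have h1 : ∀ s ∈ Set.Ici (0 : ℝ), 1 + s ≠ 0 := fun s hs => by
    have : (0 : ℝ) ≤ s := hs
    positivity
  refine ContinuousOn.div ?_ (by fun_prop) h1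
  exact (ContinuousOn.log (by fun_prop) h1).rpow_const fun _ _ => Or.inr hm

lemma intervalIntegrable_log_one_add_rpow_div {m : ℝ} (hm : 0 ≤ m) {a b : ℝ} (ha : 0 ≤ a)
    (hb : 0 ≤ b) :
    IntervalIntegrable (fun s : ℝ => Real.log (1 + s) ^ m / (1 + s)) volume a b :=
  ((continuousOn_log_one_add_rpow_div hm).mono fun _ hs =>
    (le_min ha hb).trans hs.1).intervalIntegrable

lemma intervalIntegrable_mul_log_one_add_rpow_div {m : ℝ} (hm : 0 ≤ m) {a b : ℝ} (ha : 0 ≤ a)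
    (hb : 0 ≤ b) :
    IntervalIntegrable (fun s : ℝ => s * (Real.log (1 + s) ^ m / (1 + s))) volume a b :=
  ((continuousOn_id.mul (continuousOn_log_one_add_rpow_div hm)).mono fun _ hs =>
    (le_min ha hb).trans hs.1).intervalIntegrable

lemma integral_log_one_add_rpow_div_le {m : ℝ} (hm : 0 ≤ m) {x : ℝ} (hx : 0 ≤ x) :
    ∫ s in 0..x, Real.log (1 + s) ^ m / (1 + s) ≤ Real.log (1 + x) ^ (m + 1) := by
  have hderiv : ∀ s ∈ Set.uIcc 0 x, HasDerivAt (fun s : ℝ => Real.log (1 + s) ^ (m + 1) / (m + 1))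
      (Real.log (1 + s) ^ m / (1 + s)) s := by
    intro s hs
    rw [Set.uIcc_of_le hx] at hs
    have hs0 : 0 < 1 + s := by linarith [hs.1]
    have h1 := ((((hasDerivAt_id s).const_add 1).log hs0.ne').rpow_const (p := m + 1)
      (Or.inr (by linarith))).div_const (m + 1)
    have hm1 : m + 1 ≠ 0 := by positivity
    have hval : Real.log (1 + s) ^ m / (1 + s) =
        1 / (1 + s) * (m + 1) * Real.log (1 + s) ^ (m + 1 - 1) / (m + 1) := by
      rw [add_sub_cancel_right]
      field_simp
    rw [hval]
    exact h1
  rw [intervalIntegral.integral_eq_sub_of_hasDerivAt hderiv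
    (intervalIntegrable_log_one_add_rpow_div hm le_rfl hx)]
  have h0 : 0 ≤ Real.log (1 + x) ^ (m + 1) := Real.rpow_nonneg (Real.log_nonneg (by linarith)) _
  rw [add_zero, Real.log_one, Real.zero_rpow (by positivity), zero_div, sub_zero]
  exact div_le_self h0 (by linarith)

/-- For y ≤ 2 the constant suffices. For y ≥ 2 only [y/2, y] is used: there s / (1 + s) ≥ 1/2, and
Bernoulli's 1 + 2y ≤ (1 + y/2)^4 gives log (1 + s) ≥ log (1 + 2y) / 4. The form 2y suits y = M / 2.
-/
lemma mul_log_rpow_le_integral {m : ℝ} (hm : 0 ≤ m) {y : ℝ} (hy : 0 ≤ y) :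
    2 * y * Real.log (1 + 2 * y) ^ m ≤
      4 * Real.log 5 ^ m +
        8 * 4 ^ m * ∫ s in 0..y, s * (Real.log (1 + s) ^ m / (1 + s)) := by
  have hnn : ∀ s : ℝ, 0 ≤ s → 0 ≤ s * (Real.log (1 + s) ^ m / (1 + s)) := fun s hs =>
    mul_nonneg hs (div_nonneg (Real.rpow_nonneg (Real.log_nonneg (by linarith)) _) (by linarith))
  rcases le_total y 2 with h2 | h2
  · have hI : 0 ≤ ∫ s in 0..y, s * (Real.log (1 + s) ^ m / (1 + s)) :=
      intervalIntegral.integral_nonneg hy fun s hs => hnn s hs.1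
    have h1 : 2 * y * Real.log (1 + 2 * y) ^ m ≤ 4 * Real.log 5 ^ m :=
      mul_le_mul (by linarith) (Real.rpow_le_rpow (Real.log_nonneg (by linarith))
        (Real.log_le_log (by linarith) (by linarith)) hm)
        (Real.rpow_nonneg (Real.log_nonneg (by linarith)) _) (by norm_num)
    have h3 : 0 ≤ (8 : ℝ) * 4 ^ m := by positivity
    linarith [mul_nonneg h3 hI]
  · have h5 : 0 ≤ Real.log 5 ^ m := Real.rpow_nonneg (Real.log_nonneg (by norm_num)) _
    have hL : 0 ≤ Real.log (1 + 2 * y) := Real.log_nonneg (by linarith)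
    have hlog : Real.log (1 + 2 * y) / 4 ≤ Real.log (1 + y / 2) := by
      have h := Real.log_le_log (by linarith)
        (show 1 + 2 * y ≤ (1 + y / 2) ^ 4 by
          have := one_add_mul_le_pow (by linarith : -2 ≤ y / 2) 4
          push_cast at this
          linarith)
      rw [Real.log_pow] at h
      push_cast at h
      linarith
    have hsplit := intervalIntegral.integral_add_adjacent_intervals
      (intervalIntegrable_mul_log_one_add_rpow_div hm le_rfl (by linarith : 0 ≤ y / 2))
      (intervalIntegrable_mul_log_one_add_rpow_div hm (by linarith : 0 ≤ y / 2) hy)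
    have hfirst : 0 ≤ ∫ s in 0..(y / 2), s * (Real.log (1 + s) ^ m / (1 + s)) :=
      intervalIntegral.integral_nonneg (by linarith) fun s hs => hnn s hs.1
    have hsecond : ∫ _ in (y / 2)..y, 1 / 2 * (Real.log (1 + 2 * y) / 4) ^ m ≤
        ∫ s in (y / 2)..y, s * (Real.log (1 + s) ^ m / (1 + s)) := by
      refine intervalIntegral.integral_mono_on (by linarith) (by simp)
        (intervalIntegrable_mul_log_one_add_rpow_div hm (by linarith) hy) fun s hs => ?_
      have hs1 : 1 ≤ s := by linarith [hs.1]
      have ha : (Real.log (1 + 2 * y) / 4) ^ m ≤ Real.log (1 + s) ^ m :=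
        Real.rpow_le_rpow (by positivity) (hlog.trans
          (Real.log_le_log (by linarith) (by linarith [hs.1]))) hm
      have hb : 1 / 2 ≤ s / (1 + s) := by
        rw [div_le_div_iff₀ (by norm_num) (by linarith)]
        linarith
      calc 1 / 2 * (Real.log (1 + 2 * y) / 4) ^ m ≤ s / (1 + s) * Real.log (1 + s) ^ m :=
            mul_le_mul hb ha (by positivity) (by positivity)
        _ = s * (Real.log (1 + s) ^ m / (1 + s)) := by ring
    rw [intervalIntegral.integral_const, smul_eq_mul, Real.div_rpow hL (by norm_num)] at hsecond
    have h4 : (0 : ℝ) < 4 ^ m := by positivity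
    have hkey : 2 * y * Real.log (1 + 2 * y) ^ m =
        8 * 4 ^ m * ((y - y / 2) * (1 / 2 * (Real.log (1 + 2 * y) ^ m / 4 ^ m))) := by
      field_simp
      ring
    have := mul_le_mul_of_nonneg_left (hsecond.trans (by linarith : _ ≤
      ∫ s in 0..y, s * (Real.log (1 + s) ^ m / (1 + s)))) (by positivity : 0 ≤ 8 * (4 : ℝ) ^ m)
    linarith

/-- A function dominated by an integrable one in the weak sense is finite almost everywhere. -/
lemma ae_lt_top_of_weakType {Ω : Type*} [MeasurableSpace Ω] {μ : Measure Ω}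
    {f M : Ω → ℝ≥0∞}
    (hw : ∀ t : ℝ≥0∞, t ≠ ∞ → t * μ {x | t < M x} ≤ ∫⁻ x in {x | t < M x}, f x ∂μ)
    (hfi : ∫⁻ x, f x ∂μ ≠ ∞) : ∀ᵐ x ∂μ, M x < ∞ := by
  rw [ae_iff]
  by_contra hne
  obtain ⟨n, hn⟩ := ENNReal.exists_nat_mul_gt hne hfi
  refine absurd hn (not_lt.mpr ?_)
  calc (n : ℝ≥0∞) * μ {x | ¬ M x < ∞} ≤ n * μ {x | (n : ℝ≥0∞) < M x} := by
        gcongr with x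
        intro h
        rw [not_lt_top_iff.mp h]
        exact ENNReal.natCast_lt_top n
    _ ≤ _ := (hw n (ENNReal.natCast_ne_top n)).trans (setLIntegral_le_lintegral _ _)

/-- The weak type inequality with the right hand side localized to a level set of `f`. -/
lemma mul_meas_two_mul_lt_le {Ω : Type*} [MeasurableSpace Ω] {μ : Measure Ω} [IsFiniteMeasure μ]
    {f M : Ω → ℝ≥0∞} (hf : AEMeasurable f μ)
    (hw : ∀ t : ℝ≥0∞, t ≠ ∞ → t * μ {x | t < M x} ≤ ∫⁻ x in {x | t < M x}, f x ∂μ)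
    {t : ℝ≥0∞} (ht : t ≠ ∞) :
    t * μ {x | 2 * t < M x} ≤ ∫⁻ x in {x | t < f x}, f x ∂μ := by
  have h1 := hw (2 * t) (ENNReal.mul_ne_top (by simp) ht)
  set A := {x | 2 * t < M x}
  have hn : NullMeasurableSet {x | t < f x} μ := nullMeasurableSet_lt aemeasurable_const hf
  -- Since f ≤ t + f 1_{f > t}, the low part contributes at most t μ(A), which half of 2t μ(A)
  -- absorbs; μ(A) is finite, so it cancels.
  have h2 : ∫⁻ x in A, f x ∂μ ≤ t * μ A + ∫⁻ x in {x | t < f x}, f x ∂μ := by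
    calc ∫⁻ x in A, f x ∂μ ≤ ∫⁻ x in A, (t + {x | t < f x}.indicator f x) ∂μ := by
          refine lintegral_mono fun x => ?_
          by_cases hx : t < f x
          · rw [Set.indicator_of_mem (by exact hx)]
            exact le_add_self
          · exact (not_lt.mp hx).trans le_self_add
      _ = t * μ A + ∫⁻ x in A, {x | t < f x}.indicator f x ∂μ := by
          rw [lintegral_add_left measurable_const, setLIntegral_const]
      _ ≤ t * μ A + ∫⁻ x, {x | t < f x}.indicator f x ∂μ := by
          exact add_le_add_right (setLIntegral_le_lintegral _ _) _
      _ = _ := by rw [lintegral_indicator₀ hn]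
  rw [two_mul, add_mul] at h1
  exact (ENNReal.add_le_add_iff_left (ENNReal.mul_ne_top ht (measure_ne_top _ _))).mp (h1.trans h2)

/-- A weak type inequality with a localized right hand side maps `L log ^ (m + 1) L` to
`L log ^ m L`. -/
lemma lintegral_mul_log_rpow_ne_top_of_weakType {Ω : Type*} [MeasurableSpace Ω] {μ : Measure Ω}
    [IsFiniteMeasure μ] {f M : Ω → ℝ≥0∞} (hf : AEMeasurable f μ) (hM : Measurable M)
    (hw : ∀ t : ℝ≥0∞, t ≠ ∞ → t * μ {x | t < M x} ≤ ∫⁻ x in {x | t < M x}, f x ∂μ)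
    (hfi : ∫⁻ x, f x ∂μ ≠ ∞) {m : ℝ} (hm : 0 ≤ m)
    (hfm : ∫⁻ x, ENNReal.ofReal ((f x).toReal * Real.log (1 + (f x).toReal) ^ (m + 1)) ∂μ ≠ ∞) :
    ∫⁻ x, ENNReal.ofReal ((M x).toReal * Real.log (1 + (M x).toReal) ^ m) ∂μ ≠ ∞ := by
  set ν := μ.withDensity f with hν
  have hftop : ∀ᵐ x ∂μ, f x < ∞ := ae_lt_top' hf hfi
  have hνμ : ν ≪ μ := withDensity_absolutelyContinuous μ f
  have hγ : ∀ t : ℝ, 0 < t → 0 ≤ Real.log (1 + t) ^ m / (1 + t) := fun t ht =>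
    div_nonneg (Real.rpow_nonneg (Real.log_nonneg (by linarith)) _) (by linarith)
  have hlevel : ∀ t : ℝ, 0 < t →
      ENNReal.ofReal t * μ {x | t < (M x).toReal / 2} ≤ ν {x | t < (f x).toReal} := by
    intro t ht
    calc ENNReal.ofReal t * μ {x | t < (M x).toReal / 2}
        ≤ ENNReal.ofReal t * μ {x | 2 * ENNReal.ofReal t < M x} := by
          gcongr with x
          intro h
          have h' : 2 * t < (M x).toReal := by linarith
          have := (ENNReal.lt_ofReal_iff_toReal_lt (a := ENNReal.ofReal (2 * t))
            ENNReal.ofReal_ne_top).mpr (by rwa [ENNReal.toReal_ofReal (by positivity)])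
          rw [ENNReal.ofReal_mul (by norm_num), ENNReal.ofReal_ofNat] at this
          exact this.trans_le ENNReal.ofReal_toReal_le
      _ ≤ ∫⁻ x in {x | ENNReal.ofReal t < f x}, f x ∂μ :=
          mul_meas_two_mul_lt_le hf hw ENNReal.ofReal_ne_top
      _ = ν {x | ENNReal.ofReal t < f x} := by rw [hν, withDensity_apply']
      _ ≤ ν {x | t < (f x).toReal} := by
          refine measure_mono_ae ?_
          filter_upwards [hνμ.ae_le hftop] with x hx h
          exact (ENNReal.ofReal_lt_iff_lt_toReal ht.le hx.ne).mp h
  -- In the layer cake for M / 2, the factor t of the density t w(t) is spent on the weak type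
  -- inequality. What remains is the layer cake of ∫ w under f dμ, hence f log^(m + 1).
  have hΦ : ∫⁻ x, ENNReal.ofReal
      (∫ s in 0..((M x).toReal / 2), s * (Real.log (1 + s) ^ m / (1 + s))) ∂μ ≠ ∞ := by
    rw [lintegral_comp_eq_lintegral_meas_lt_mul μ (ae_of_all _ fun x => by positivity)
      (hM.ennreal_toReal.div_const 2).aemeasurable
      (fun t ht => intervalIntegrable_mul_log_one_add_rpow_div hm le_rfl ht.le)
      ((ae_restrict_iff' measurableSet_Ioi).mpr (ae_of_all _ fun t ht =>
        mul_nonneg (le_of_lt ht) (hγ t ht)))]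
    have hle : ∫⁻ t in Set.Ioi (0 : ℝ), μ {x | t < (M x).toReal / 2} *
        ENNReal.ofReal (t * (Real.log (1 + t) ^ m / (1 + t))) ≤
        ∫⁻ t in Set.Ioi (0 : ℝ), ν {x | t < (f x).toReal} *
          ENNReal.ofReal (Real.log (1 + t) ^ m / (1 + t)) := by
      refine setLIntegral_mono' measurableSet_Ioi fun t ht => ?_
      rw [ENNReal.ofReal_mul (le_of_lt ht), ← mul_assoc, mul_comm (μ _)]
      gcongr
      exact hlevel t ht
    refine ne_top_of_le_ne_top ?_ hle
    rw [← lintegral_comp_eq_lintegral_meas_lt_mul ν (ae_of_all _ fun x => ENNReal.toReal_nonneg)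
      (hf.ennreal_toReal.mono_ac hνμ)
      (fun t ht => intervalIntegrable_log_one_add_rpow_div hm le_rfl ht.le)
      ((ae_restrict_iff' measurableSet_Ioi).mpr (ae_of_all _ fun t ht => hγ t ht))]
    refine ne_top_of_le_ne_top ?_ (lintegral_mono fun x => ENNReal.ofReal_le_ofReal
      (integral_log_one_add_rpow_div_le hm (ENNReal.toReal_nonneg (a := f x))))
    have hmeas : AEMeasurable
        (fun x => ENNReal.ofReal (Real.log (1 + (f x).toReal) ^ (m + 1))) μ := by
      have := hf.ennreal_toReal
      fun_prop
    rw [hν, lintegral_withDensity_eq_lintegral_mul₀ hf hmeas]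
    refine ne_of_eq_of_ne (lintegral_congr_ae ?_) hfm
    filter_upwards [hftop] with x hx
    rw [ENNReal.ofReal_mul ENNReal.toReal_nonneg, ENNReal.ofReal_toReal hx.ne]
    rfl
  have hle : ∫⁻ x, ENNReal.ofReal ((M x).toReal * Real.log (1 + (M x).toReal) ^ m) ∂μ ≤
      ∫⁻ x, (ENNReal.ofReal (4 * Real.log 5 ^ m) + ENNReal.ofReal (8 * 4 ^ m) * ENNReal.ofReal
        (∫ s in 0..((M x).toReal / 2), s * (Real.log (1 + s) ^ m / (1 + s)))) ∂μ := by
    refine lintegral_mono fun x => ?_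
    have h := mul_log_rpow_le_integral hm (y := (M x).toReal / 2) (by positivity)
    rw [mul_div_cancel₀ _ (by norm_num : (2 : ℝ) ≠ 0)] at h
    rw [← ENNReal.ofReal_mul (by positivity)]
    exact (ENNReal.ofReal_le_ofReal h).trans ENNReal.ofReal_add_le
  refine ne_top_of_le_ne_top ?_ hle
  rw [lintegral_add_left measurable_const, lintegral_const,
    lintegral_const_mul' _ _ ENNReal.ofReal_ne_top]
  exact ENNReal.add_ne_top.mpr ⟨ENNReal.mul_ne_top ENNReal.ofReal_ne_top (measure_ne_top _ _),
    ENNReal.mul_ne_top ENNReal.ofReal_ne_top hΦ⟩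

lemma le_two_add_mul_log_rpow {m x : ℝ} (hm : 0 ≤ m) (hx : 0 ≤ x) :
    x ≤ 2 + x * Real.log (1 + x) ^ m := by
  have h0 : 0 ≤ Real.log (1 + x) ^ m := Real.rpow_nonneg (Real.log_nonneg (by linarith)) _
  rcases le_total x 2 with h | h
  · linarith [mul_nonneg hx h0]
  · have h1 : 1 ≤ Real.log (1 + x) := by
      rw [Real.le_log_iff_exp_le (by linarith)]
      linarith [Real.exp_one_lt_d9]
    linarith [mul_le_mul_of_nonneg_left (Real.one_le_rpow h1 hm) hx]

/-- For x ≥ 2 it follows from 1 + x ≤ x². It passes from the log⁺ of the hypothesis to the weight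
log (1 + x). -/
lemma mul_log_one_add_rpow_le {m x : ℝ} (hm : 0 ≤ m) (hx : 0 ≤ x) :
    x * Real.log (1 + x) ^ m ≤ 2 * Real.log 3 ^ m + 2 ^ m * (x * Real.log (max 1 x) ^ m) := by
  have h0 : 0 ≤ x * Real.log (max 1 x) ^ m :=
    mul_nonneg hx (Real.rpow_nonneg (Real.log_nonneg (le_max_left _ _)) _)
  have h3 : 0 ≤ Real.log 3 ^ m := Real.rpow_nonneg (Real.log_nonneg (by norm_num)) _
  rcases le_total x 2 with h | h
  · have h1 : x * Real.log (1 + x) ^ m ≤ 2 * Real.log 3 ^ m :=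
      mul_le_mul h (Real.rpow_le_rpow (Real.log_nonneg (by linarith))
        (Real.log_le_log (by linarith) (by linarith)) hm)
        (Real.rpow_nonneg (Real.log_nonneg (by linarith)) _) (by norm_num)
    linarith [mul_nonneg (by positivity : (0 : ℝ) ≤ 2 ^ m) h0]
  · have hl : Real.log (1 + x) ≤ 2 * Real.log x := by
      have := Real.log_le_log (by linarith) (show 1 + x ≤ x ^ 2 by nlinarith)
      rw [Real.log_pow] at this
      exact_mod_cast this
    have h1 : Real.log (1 + x) ^ m ≤ 2 ^ m * Real.log x ^ m := by
      rw [← Real.mul_rpow (by norm_num) (Real.log_nonneg (by linarith))]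
      exact Real.rpow_le_rpow (Real.log_nonneg (by linarith)) hl hm
    rw [max_eq_right (by linarith)]
    nlinarith [mul_le_mul_of_nonneg_left h1 hx]

lemma lintegral_ne_top_of_mul_log_rpow {Ω : Type*} [MeasurableSpace Ω] {μ : Measure Ω}
    [IsFiniteMeasure μ] {f : Ω → ℝ≥0∞} (hf : ∀ᵐ x ∂μ, f x < ∞) {m : ℝ} (hm : 0 ≤ m)
    (hfm : ∫⁻ x, ENNReal.ofReal ((f x).toReal * Real.log (1 + (f x).toReal) ^ m) ∂μ ≠ ∞) :
    ∫⁻ x, f x ∂μ ≠ ∞ := by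
  have hle : ∫⁻ x, f x ∂μ ≤ ∫⁻ x, (ENNReal.ofReal 2 +
      ENNReal.ofReal ((f x).toReal * Real.log (1 + (f x).toReal) ^ m)) ∂μ := by
    refine lintegral_mono_ae ?_
    filter_upwards [hf] with x hx
    rw [← ENNReal.ofReal_toReal hx.ne]
    refine (ENNReal.ofReal_le_ofReal
      (le_two_add_mul_log_rpow hm (ENNReal.toReal_nonneg (a := f x)))).trans ?_
    rw [ENNReal.ofReal_toReal hx.ne]
    exact ENNReal.ofReal_add_le
  refine ne_top_of_le_ne_top ?_ hle
  rw [lintegral_add_left measurable_const, lintegral_const]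
  exact ENNReal.add_ne_top.mpr ⟨ENNReal.mul_ne_top ENNReal.ofReal_ne_top (measure_ne_top _ _), hfm⟩

lemma MemLLogL.lintegral_mul_log_rpow_ne_top {Ω X : Type*} [MeasurableSpace Ω]
    [NormedAddCommGroup X] {μ : Measure Ω} [IsFiniteMeasure μ] {m : ℝ} (hm : 0 ≤ m) {g : Ω → X}
    (hg : MemLLogL m g μ) :
    ∫⁻ x, ENNReal.ofReal (‖g x‖ * Real.log (1 + ‖g x‖) ^ m) ∂μ ≠ ∞ := by
  have hint : Integrable (fun x => 2 * Real.log 3 ^ m +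
      2 ^ m * (‖g x‖ * Real.log (max 1 ‖g x‖) ^ m)) μ :=
    (integrable_const _).add (hg.2.const_mul _)
  exact ne_top_of_le_ne_top hint.lintegral_lt_top.ne (lintegral_mono fun x =>
    ENNReal.ofReal_le_ofReal (mul_log_one_add_rpow_le hm (norm_nonneg _)))

/-! ### The ergodic martingale supremum -/

lemma ergodicMartingaleSup_le {Ω X : Type*} [MeasurableSpace Ω]
    [NormedAddCommGroup X] [NormedSpace ℝ X] [CompleteSpace X]
    (μ : Measure Ω) (τ : Ω → Ω) (F : ℕ → MeasurableSpace Ω) (f : Ω → X) (ω : Ω) :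
    ergodicMartingaleSup μ τ F f ω ≤ ergodicSup τ (fun x => ⨆ n, ‖(μ[f|F n]) x‖ₑ) ω := by
  refine iSup_mono fun k => iSup_mono fun hk => iSup_le fun n => ?_
  rw [birkhoffAverage, enorm_smul]
  have hk0 : (k : ℝ) ≠ 0 := by positivity
  rw [enorm_inv hk0, show ‖(k : ℝ)‖ₑ = k by simp]
  gcongr
  rw [birkhoffSum]
  exact (enorm_sum_le _ _).trans (Finset.sum_le_sum fun i _ => 
    le_iSup (fun n => ‖(μ[f|F n]) (τ^[i] ω)‖ₑ) n)

lemma measurable_ergodicMartingaleSup {Ω X : Type*} {mΩ : MeasurableSpace Ω}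
    [NormedAddCommGroup X] [NormedSpace ℝ X] [CompleteSpace X]
    (μ : Measure Ω) {τ : Ω → Ω} (hτ : Measurable τ) {F : ℕ → MeasurableSpace Ω}
    (hFle : ∀ n, F n ≤ mΩ) (f : Ω → X) : Measurable (ergodicMartingaleSup μ τ F f) := by
  refine Measurable.iSup fun k => Measurable.iSup fun _ => Measurable.iSup fun n => ?_
  have : StronglyMeasurable (birkhoffAverage ℝ τ (μ[f|F n]) k) := by
    refine StronglyMeasurable.const_smul ?_ _
    exact Finset.stronglyMeasurable_fun_sum _ fun i _ =>
      (stronglyMeasurable_condExp.mono (hFle n)).comp_measurable (hτ.iterate i)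
  exact this.enorm

theorem theorem3p4
    {Ω X : Type*} [mΩ : MeasurableSpace Ω]
    [NormedAddCommGroup X] [NormedSpace ℝ X] [CompleteSpace X] (hX : IsReflexiveSpace X)
    (μ : Measure Ω) [IsFiniteMeasure μ]
    (τ : Ω → Ω) (hτ : MeasurePreserving τ μ μ)
    (F : ℕ → MeasurableSpace Ω) (hFle : ∀ n, F n ≤ mΩ) (hF : Monotone F ∨ Antitone F) :
    (∀ (p : ℝ), 1 < p → ∀ f : Ω → X, MemLp f (ENNReal.ofReal p) μ →
      ∫⁻ ω, ⨆ n, ‖(μ[f|F n]) ω‖ₑ ∂μ < ∞ →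
      eLpNorm (ergodicMartingaleSup μ τ F f) (ENNReal.ofReal p) μ
        ≤ ENNReal.ofReal ((p / (p - 1)) ^ 2) * eLpNorm f (ENNReal.ofReal p) μ) ∧
    (∀ (m : ℝ), 0 ≤ m → ∀ f : Ω → X, MemLLogL (m + 2) f μ →
      (∀ᵐ ω ∂μ, ergodicMartingaleSup μ τ F f ω < ∞) ∧
      MemLLogL m (fun ω => (ergodicMartingaleSup μ τ F f ω).toReal) μ) := by
  have hhm : ∀ f : Ω → X, Measurable fun ω => ⨆ n, ‖(μ[f|F n]) ω‖ₑ := fun f =>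
    Measurable.iSup fun n => (stronglyMeasurable_condExp.mono (hFle n)).enorm
  have hSm : ∀ f : Ω → X, Measurable (ergodicSup τ fun ω => ⨆ n, ‖(μ[f|F n]) ω‖ₑ) := fun f =>
    measurable_ergodicSup hτ.measurable (hhm f)
  constructor
  · intro p hp f hf _
    have hp0 : 0 < p := by linarith
    have hp1 : 0 < p - 1 := by linarith
    have hfint : Integrable f μ := hf.integrable (by simpa using hp.le)
    have hDoob := lintegral_rpow_le_of_weakType hf.1.enorm (hhm f)
      (fun t _ => mul_meas_iSup_condExp_le μ hFle hF hfint t) hp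
    have hErg := lintegral_rpow_le_of_weakType (hhm f).aemeasurable (hSm f)
      (fun t ht => mul_meas_ergodicSup_le hτ (hhm f) ht) hp
    have hpz : ENNReal.ofReal p ≠ 0 := by simpa using hp0
    rw [eLpNorm_eq_lintegral_rpow_enorm_toReal hpz ENNReal.ofReal_ne_top,
      eLpNorm_eq_lintegral_rpow_enorm_toReal hpz ENNReal.ofReal_ne_top,
      ENNReal.toReal_ofReal hp0.le, sq, ENNReal.ofReal_mul (by positivity), mul_assoc]
    refine le_trans ?_ (hErg.trans (by gcongr))
    gcongr with ω
    simpa using ergodicMartingaleSup_le μ τ F f ω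
  · intro m hm f hf
    have hfm := hf.lintegral_mul_log_rpow_ne_top (by linarith)
    -- The martingale step is applied at exponent m + 1 and the ergodic step at m.
    rw [show m + 2 = m + 1 + 1 by ring] at hfm
    simp_rw [← toReal_enorm] at hfm
    have hfi : ∫⁻ ω, ‖f ω‖ₑ ∂μ ≠ ∞ := lintegral_ne_top_of_mul_log_rpow
      (ae_of_all _ fun ω => enorm_lt_top) (by linarith) hfm
    have hfint : Integrable f μ := ⟨hf.1, hfi.lt_top⟩
    have hwD := fun t (_ : t ≠ ∞) => mul_meas_iSup_condExp_le μ hFle hF hfint t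
    have hhlog := lintegral_mul_log_rpow_ne_top_of_weakType hf.1.enorm (hhm f) hwD hfi
      (by linarith) hfm
    have hhi := lintegral_ne_top_of_mul_log_rpow (ae_lt_top_of_weakType hwD hfi)
      (by linarith) hhlog
    have hwE := fun t (ht : t ≠ ∞) => mul_meas_ergodicSup_le hτ (hhm f) ht
    have hElog := lintegral_mul_log_rpow_ne_top_of_weakType (hhm f).aemeasurable (hSm f) hwE hhi
      hm hhlog
    have hEfin := ae_lt_top_of_weakType hwE hhi
    have hmeas := (measurable_ergodicMartingaleSup μ hτ.measurable hFle f).ennreal_toReal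
    refine ⟨hEfin.mono fun ω h => (ergodicMartingaleSup_le μ τ F f ω).trans_lt h,
      hmeas.aestronglyMeasurable, ?_, ?_⟩
    · exact (hmeas.norm.mul ((Real.measurable_log.comp
        (measurable_const.max hmeas.norm)).pow_const m)).aestronglyMeasurable
    · rw [hasFiniteIntegral_iff_ofReal (ae_of_all _ fun ω => mul_nonneg (norm_nonneg _)
        (Real.rpow_nonneg (Real.log_nonneg (le_max_left _ _)) _))]
      refine lt_of_le_of_lt (lintegral_mono_ae ?_) hElog.lt_top
      -- Finiteness is needed because `toReal` sends ∞ to 0 and is monotone only below a finite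
      -- bound.
      filter_upwards [hEfin] with ω hω
      rw [Real.norm_of_nonneg ENNReal.toReal_nonneg]
      have hle := ENNReal.toReal_mono hω.ne (ergodicMartingaleSup_le μ τ F f ω)
      have h0 : 0 ≤ (ergodicMartingaleSup μ τ F f ω).toReal := ENNReal.toReal_nonneg
      refine ENNReal.ofReal_le_ofReal (mul_le_mul hle (Real.rpow_le_rpow
        (Real.log_nonneg (le_max_left _ _)) (Real.log_le_log (by positivity)
          (max_le (by linarith) (by linarith))) hm)
        (Real.rpow_nonneg (Real.log_nonneg (le_max_left _ _)) _) (h0.trans hle))
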